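/- Let $D$ be a division ring with center $F$. Call a division ring centrally finite if it is finite-dimensional as a vector space over its center, and assume that $D$ is weakly locally finite, i.e. that for every finite subset $S \subseteq D$ the division subring of $D$ generated by $S$ is centrally finite. Let $K \subsetneq D$ be a proper division subring, and let $N$ be a normal subgroup of the multiplicative group $D^* = D \setminus \{0\}$ that is radical over $K$, i.e. for every $x \in N$ there is a positive integer $n$ (depending on $x$) with $x^n \in K$. Then $N \subseteq F$. -/

import Mathlib

/-- A division ring is centrally finite if it is finite-dimensional as a vector space over its
center. -/
def IsCentrallyFinite (D : Type*) [DivisionRing D] : Prop :=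
  FiniteDimensional (Subring.center D) D

/-- A division ring is weakly locally finite if every finite subset generates a centrally finite
division subring. (Mathlib's `Subfield D` is the type of division subrings of `D`; its elements are
not required to be commutative.) -/
def IsWeaklyLocallyFinite (D : Type*) [DivisionRing D] : Prop :=
  ∀ S : Set D, S.Finite → IsCentrallyFinite (Subfield.closure S)

/-- An element `x` is radical over a division subring `K` if some positive power of `x` lies
in `K`; the exponent may depend on `x`. -/
def IsRadicalElementOver {D : Type*} [DivisionRing D] (K : Subfield D) (x : D) : Prop :=
  ∃ n : ℕ, 0 < n ∧ x ^ n ∈ K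

/-- A subset is radical over a division subring `K` if each of its elements is. -/
def IsRadicalOver {D : Type*} [DivisionRing D] (K : Subfield D) (S : Set D) : Prop :=
  ∀ x ∈ S, IsRadicalElementOver K x

/-! Given `x` in `N` and `y` in `D`, let `E` be the division subring they generate,
finite-dimensional over its center `F`. A Cartan–Brauer–Hua argument shows that each element of `N`
has, for any given element of `D`, a power commuting with it. Elements of `N ∩ E` therefore have
powers commuting with both `x` and `y`, so `N ∩ E` is radical over `F`.

In `E`, commutators have norm 1, so those in `N ∩ E` have finite order. If `F` has a suitable
nontrivial valuation ring, `E` contains an order in which torsion elements close enough to 1 are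
trivial. For `g = 1 + t • a` with `t` deep in the valuation ideal, `⁅g, x⁆` is such an element, so
`x` commutes with `a`. Otherwise `F` is algebraic over a finite field and Wedderburn's little
theorem makes `E` commutative. -/

/-! ### Orders and torsion near 1 -/

open IsLocalRing in
/-- A division algebra of finite dimension over the fraction field of a local domain `A` contains
an `A`-order whose elements congruent to `1` modulo the maximal ideal of `A` are units. -/
theorem exists_order {A F D : Type*} [CommRing A] [IsLocalRing A] [Field F] [DivisionRing D]
    [Algebra A F] [IsFractionRing A F] [Algebra F D] [Algebra A D] [IsScalarTower A F D]
    [FiniteDimensional F D] :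
    ∃ M : Subalgebra A D, (∀ y : D, ∃ s : A, s ≠ 0 ∧ s • y ∈ M) ∧
      ∀ s ∈ maximalIdeal A, ∀ y ∈ M, 1 + s • y ≠ 0 ∧ (1 + s • y)⁻¹ ∈ M := by
  have b := Module.finBasis F D
  set Λ : Submodule A D := Submodule.span A (Set.range b) with hΛ
  have hfg : Λ.FG := Submodule.fg_span (Set.finite_range b)
  have hne : Λ ≠ ⊥ := by
    intro h
    have h0 : ∀ i, b i = 0 := fun i => by
      have : b i ∈ Λ := Submodule.subset_span ⟨i, rfl⟩
      rwa [h, Submodule.mem_bot] at this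
    obtain ⟨i⟩ := b.index_nonempty
    exact b.ne_zero i (h0 i)
  -- The left order of the lattice `Λ`.
  let M : Subalgebra A D :=
    { carrier := {y | ∀ l ∈ Λ, y * l ∈ Λ}
      mul_mem' := fun {a b} ha hb l hl => by rw [mul_assoc]; exact ha _ (hb _ hl)
      add_mem' := fun {a b} ha hb l hl => by rw [add_mul]; exact add_mem (ha _ hl) (hb _ hl)
      algebraMap_mem' := fun r l hl => by
        rw [← Algebra.smul_def]; exact Λ.smul_mem _ hl }
  have hM : ∀ y, y ∈ M ↔ ∀ l ∈ Λ, y * l ∈ Λ := fun y => Iff.rfl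
  refine ⟨M, fun y => ?_, fun s hs y hy => ?_⟩
  · obtain ⟨s, hs⟩ := IsLocalization.exist_integer_multiples_of_finite (nonZeroDivisors A)
      (fun p : Fin (Module.finrank F D) × Fin (Module.finrank F D) => b.repr (y * b p.1) p.2)
    refine ⟨s, nonZeroDivisors.ne_zero s.2, (hM _).2 fun l hl => ?_⟩
    induction hl using Submodule.span_induction with
    | mem l hl =>
      obtain ⟨i, rfl⟩ := hl
      rw [smul_mul_assoc, ← b.sum_repr (y * b i), Finset.smul_sum]
      refine sum_mem fun j _ => ?_
      obtain ⟨r, hr⟩ := hs (i, j)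
      rw [← smul_assoc, ← hr, algebraMap_smul]
      exact Λ.smul_mem _ (Submodule.subset_span ⟨j, rfl⟩)
    | zero => simp
    | add l l' _ _ h h' => rw [mul_add]; exact add_mem h h'
    | smul r l _ h => rw [mul_smul_comm]; exact Λ.smul_mem _ h
  -- Nakayama: `Λ = (1 + s • y)Λ + 𝔪Λ`, so `1 + s • y` maps `Λ` onto itself and its inverse
  -- preserves `Λ`.
  · have key : Λ ≤ Λ.map (LinearMap.mulLeft A (1 + s • y)) := by
      refine Submodule.le_of_le_smul_of_le_jacobson_bot (I := maximalIdeal A) hfg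
        (maximalIdeal_le_jacobson _) fun l hl => ?_
      refine Submodule.mem_sup.2 ⟨(1 + s • y) * l, ⟨l, hl, rfl⟩, s • (-(y * l)),
        Submodule.smul_mem_smul hs (neg_mem (hy l hl)), ?_⟩
      rw [add_mul, one_mul, smul_neg, smul_mul_assoc, add_neg_cancel_right]
    have h0 : 1 + s • y ≠ 0 := by
      intro h
      refine hne (eq_bot_iff.2 (key.trans ?_))
      rintro _ ⟨l, _, rfl⟩
      simp [h]
    refine ⟨h0, (hM _).2 fun l hl => ?_⟩
    obtain ⟨l', hl', rfl⟩ := key hl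
    rw [LinearMap.mulLeft_apply, inv_mul_cancel_left₀ h0]
    exact hl'

open IsLocalRing in
/-- Elements of finite order sufficiently close to `1` in an order are trivial. -/
theorem eq_one_of_pow_eq_one_of_near_one {A D : Type*} [CommRing A] [IsLocalRing A]
    [DivisionRing D] [Algebra A D] (M : Subalgebra A D)
    (hM : ∀ s ∈ maximalIdeal A, ∀ y ∈ M, 1 + s • y ≠ 0) {s : A}
    (hs : ∀ q : ℕ, q.Prime → (q : D) = 0 ∨ ∃ r ∈ maximalIdeal A, s = q * r) (n : ℕ) (hn : 0 < n)
    (u : D) (hu : ∃ e ∈ M, u = 1 + s • e) (hun : u ^ n = 1) : u = 1 := by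
  have hpow : ∀ u : D, (∃ e ∈ M, u = 1 + s • e) → ∀ k : ℕ, ∃ e ∈ M, u ^ k = 1 + s • e := by
    rintro u ⟨e, he, rfl⟩ k
    induction k with
    | zero => exact ⟨0, zero_mem _, by simp⟩
    | succ k ih =>
      obtain ⟨f, hf, hk⟩ := ih
      refine ⟨e + f + s • (f * e), add_mem (add_mem he hf) (M.smul_mem (mul_mem hf he) _), ?_⟩
      rw [pow_succ, hk]
      simp only [add_mul, mul_add, one_mul, mul_one, smul_add, smul_mul_assoc, mul_smul_comm]
      abel
  induction n using Nat.strong_induction_on generalizing u with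
  | _ n ih =>
    obtain rfl | h1 := eq_or_ne n 1
    · simpa using hun
    have hq := Nat.minFac_prime h1
    set q := n.minFac
    obtain ⟨k, hk⟩ : q ∣ n := Nat.minFac_dvd n
    have hk0 : 0 < k := Nat.pos_of_ne_zero (by rintro rfl; omega)
    have huq : u ^ q = 1 := by
      refine ih k ?_ hk0 _ (hpow u hu q) (by rw [← pow_mul, ← hk, hun])
      rw [hk]; exact lt_mul_left hk0 hq.one_lt
    by_cases h0 : (q : D) = 0
    · have : Fact q.Prime := ⟨hq⟩
      have : CharP D q := (CharP.charP_iff_prime_eq_zero hq).2 h0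
      have h2 : (u - 1) ^ q = 0 := by
        rw [sub_pow_char_of_commute q (Commute.one_right u), huq, one_pow, sub_self]
      exact sub_eq_zero.1 (pow_eq_zero_iff hq.ne_zero |>.1 h2)
    · obtain ⟨r, hr, hsr⟩ := (hs q hq).resolve_left h0
      by_contra hne
      choose e he hue using hpow u hu
      -- If `u ≠ 1`, the geometric sum vanishes; but it is `q` plus a multiple of `s = q * r`, that
      -- is, `q` times an element `1 + r • y` with `y` in `M`, which is nonzero.
      have h2 : (u - 1) * ∑ i ∈ Finset.range q, u ^ i = 0 := by rw [mul_geom_sum, huq, sub_self]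
      have h3 := (mul_eq_zero.1 h2).resolve_left (sub_ne_zero.2 hne)
      have h4 : (q : D) * (1 + r • ∑ i ∈ Finset.range q, e i) = 0 := by
        rw [← h3, Finset.sum_congr rfl fun i _ => hue i, Finset.sum_add_distrib, hsr,
          ← Finset.smul_sum, mul_smul]
        simp [mul_add, Algebra.smul_def]
      exact hM r hr _ (sum_mem fun i _ => he i) ((mul_eq_zero.1 h4).resolve_left h0)

/-! ### Base fields algebraic over a finite field -/

/-- A division algebra of finite dimension over an algebraic extension of a finite field is
commutative. -/
theorem commute_of_algebraic_over_finite {k F D : Type*} [Field k] [Finite k] [Field F]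
    [Algebra k F] [Algebra.IsAlgebraic k F] [DivisionRing D] [Algebra F D] [FiniteDimensional F D]
    (x y : D) : Commute x y := by
  have b := Module.finBasis F D
  -- The structure constants and the coordinates of `1`, `x`, `y` generate a finite field, over
  -- which the basis spans a finite domain containing `x` and `y`.
  let T : Set F := (Set.range fun p : Fin (Module.finrank F D) × Fin (Module.finrank F D) ×
      Fin (Module.finrank F D) => b.repr (b p.1 * b p.2.1) p.2.2) ∪
    Set.range (b.repr 1) ∪ Set.range (b.repr x) ∪ Set.range (b.repr y)
  have hT : T.Finite :=
    (((Set.finite_range _).union (Set.finite_range _)).union (Set.finite_range _)).union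
      (Set.finite_range _)
  let F₀ := IntermediateField.adjoin k T
  have hTF : T ⊆ F₀ := IntermediateField.subset_adjoin k T
  have : Finite T := hT
  have : FiniteDimensional k F₀ :=
    IntermediateField.finiteDimensional_adjoin fun z _ => Algebra.IsIntegral.isIntegral z
  have : Finite F₀ := Module.finite_of_finite k
  let P : Submodule F₀ D := Submodule.span F₀ (Set.range b)
  have hP : ∀ z : D, (∀ i, b.repr z i ∈ F₀) → z ∈ P := by
    intro z hz
    rw [← b.sum_repr z]
    exact sum_mem fun i _ => P.smul_mem (⟨b.repr z i, hz i⟩ : F₀) (Submodule.subset_span ⟨i, rfl⟩)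
  have h1 : (1 : D) ∈ P := hP 1 fun i => hTF (Or.inl (Or.inl (Or.inr ⟨i, rfl⟩)))
  have hmul : P * P ≤ P := by
    rw [Submodule.span_mul_span, Submodule.span_le]
    rintro _ ⟨_, ⟨i, rfl⟩, _, ⟨j, rfl⟩, rfl⟩
    exact hP _ fun l => hTF (Or.inl (Or.inl (Or.inl ⟨(i, j, l), rfl⟩)))
  let S : Subalgebra F₀ D := P.toSubalgebra h1 fun u v hu hv => hmul (Submodule.mul_mem_mul hu hv)
  have : Module.Finite F₀ P := Module.Finite.span_of_finite F₀ (Set.finite_range b)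
  have : Finite P := Module.finite_of_finite F₀
  have : Finite S := this
  have hx : x ∈ S := hP x fun i => hTF (Or.inl (Or.inr ⟨i, rfl⟩))
  have hy : y ∈ S := hP y fun i => hTF (Or.inr ⟨i, rfl⟩)
  exact congrArg Subtype.val ((Finite.isDomain_to_isField S).mul_comm ⟨x, hx⟩ ⟨y, hy⟩)

/-! ### Existence of valuation rings -/

open IsLocalRing in
/-- A field of characteristic zero has a valuation ring with residue characteristic `2`. -/
theorem exists_valuationSubring_of_charZero (F : Type*) [Field F] [CharZero F] :
    ∃ V : ValuationSubring F, ∃ s ∈ maximalIdeal V, s ≠ 0 ∧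
      ∀ q : ℕ, q.Prime → ∃ r ∈ maximalIdeal V, s = q * r := by
  let R : Subring F := (Int.castRingHom F).range
  have hI : Ideal.span {(2 : R)} ≠ ⊤ := by
    intro h
    obtain ⟨⟨_, c, rfl⟩, hc⟩ := Ideal.mem_span_singleton'.1 ((Ideal.eq_top_iff_one _).1 h)
    have h2 : (c : F) * 2 = 1 := congrArg Subtype.val hc
    have h3 : c * 2 = 1 := by exact_mod_cast h2
    omega
  obtain ⟨V, -, hV⟩ := Ideal.image_subset_nonunits_valuationSubring _ hI
  have h2 : (2 : V) ∈ maximalIdeal V := by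
    have := hV ⟨2, Ideal.subset_span rfl, rfl⟩
    exact (V.coe_mem_nonunits_iff (a := 2)).1 this
  -- With `4` rather than `2`, the quotient by the prime 2 still lies in the maximal ideal; odd
  -- primes are units of `V`.
  refine ⟨V, 2 * 2, Ideal.mul_mem_left _ _ h2, by simp, fun q hq => ?_⟩
  obtain rfl | hodd := hq.eq_two_or_odd'
  · exact ⟨2, h2, by simp⟩
  · obtain ⟨k, rfl⟩ := hodd
    have hu : IsUnit ((2 * k + 1 : ℕ) : V) := by
      by_contra h
      have h3 : ((2 * k + 1 : ℕ) : V) ∈ maximalIdeal V := h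
      have h4 := sub_mem h3 (Ideal.mul_mem_right (k : V) _ h2)
      push_cast at h4
      rw [add_sub_cancel_left] at h4
      exact (Ideal.ne_top_iff_one _).1 (maximalIdeal.isMaximal V).ne_top h4
    obtain ⟨w, hw⟩ := hu
    refine ⟨w⁻¹.1 * (2 * 2), Ideal.mul_mem_left _ _ (Ideal.mul_mem_left _ _ h2), ?_⟩
    rw [← hw, Units.mul_inv_cancel_left]

open IsLocalRing in
/-- A field of characteristic `p` that is not algebraic over its prime field has a nontrivial
valuation ring. -/
theorem exists_valuationSubring_of_charP (F : Type*) [Field F] (p : ℕ) [Fact p.Prime] [CharP F p]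
    [Algebra (ZMod p) F] (h : ¬ Algebra.IsAlgebraic (ZMod p) F) :
    ∃ V : ValuationSubring F, ∃ s ∈ maximalIdeal V, s ≠ 0 ∧
      ∀ q : ℕ, q.Prime → (q : F) = 0 ∨ ∃ r ∈ maximalIdeal V, s = q * r := by
  obtain ⟨z, hz⟩ : ∃ z : F, ¬ IsIntegral (ZMod p) z := by
    by_contra! h'
    exact h ⟨fun z => (h' z).isAlgebraic⟩
  let R : Subring F := (integralClosure (ZMod p) F).toSubring
  have : IsIntegrallyClosedIn R F :=
    inferInstanceAs (IsIntegrallyClosedIn (integralClosure (ZMod p) F) F)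
  obtain ⟨V, -, hzV⟩ :=
    Subring.exists_le_valuationSubring_of_isIntegrallyClosedIn (R := R) (x := z) hz
  have hz0 : z ≠ 0 := by rintro rfl; exact hzV (zero_mem _)
  have hm : z⁻¹ ∈ V.nonunits := V.inv_mem_nonunits_iff.2 (Or.inr hzV)
  obtain ⟨s, hs, hsz⟩ : ∃ s ∈ maximalIdeal V, (s : F) = z⁻¹ := by
    rw [← SetLike.mem_coe, ← V.image_maximalIdeal] at hm
    obtain ⟨s, hs, h⟩ := hm
    exact ⟨s, hs, h⟩
  refine ⟨V, s, hs, fun h0 => inv_ne_zero hz0 (by rw [← hsz, h0]; rfl), fun q hq => ?_⟩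
  obtain rfl | hqp := eq_or_ne q p
  · exact Or.inl (CharP.cast_eq_zero F q)
  · right
    have hc : IsCoprime (q : ℤ) p :=
      Nat.isCoprime_iff_coprime.2 ((Nat.coprime_primes hq Fact.out).2 hqp)
    obtain ⟨a, c, hac⟩ := hc
    have h1 : (a : V) * q = 1 := by
      have := congrArg (Int.cast : ℤ → F) hac
      push_cast at this
      rw [CharP.cast_eq_zero F p, mul_zero, add_zero] at this
      exact Subtype.ext (by push_cast; exact this)
    refine ⟨a * s, Ideal.mul_mem_left _ _ hs, ?_⟩
    rw [← mul_assoc, mul_comm (q : V), h1, one_mul]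

/-! ### Radical normal subgroups in finite dimension -/

open scoped commutatorElement in
/-- In a finite-dimensional division algebra over a field, a commutator of units with some positive
power in the base field has finite order. -/
theorem isOfFinOrder_commutator_of_pow_mem {F D : Type*} [Field F] [DivisionRing D] [Algebra F D]
    [FiniteDimensional F D] (g x : Dˣ) {n : ℕ} (hn : 0 < n) {f : F}
    (h : ((⁅g, x⁆ : Dˣ) : D) ^ n = algebraMap F D f) :
    ∃ m : ℕ, 0 < m ∧ ((⁅g, x⁆ : Dˣ) : D) ^ m = 1 := by
  have h1 : Algebra.norm F ((⁅g, x⁆ : Dˣ) : D) = 1 := by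
    have : Units.map (Algebra.norm F (S := D)) ⁅g, x⁆ = 1 := by
      rw [map_commutatorElement, commutatorElement_eq_one_iff_commute]
      exact Commute.all _ _
    exact congrArg Units.val this
  refine ⟨n * Module.finrank F D, Nat.mul_pos hn Module.finrank_pos, ?_⟩
  have h2 := congrArg (Algebra.norm F) h
  rw [map_pow, h1, one_pow, Algebra.norm_algebraMap] at h2
  rw [pow_mul, h, ← map_pow, ← h2, map_one]

open IsLocalRing commutatorElement in
/-- The central step: in the presence of a suitable valuation ring of the base field, a normal
subgroup of a finite-dimensional division algebra which is radical over the base field is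
central. -/
theorem commute_of_radical_of_valuationSubring {F D : Type*} [Field F] [DivisionRing D]
    [Algebra F D] [FiniteDimensional F D] (N : Subgroup Dˣ) [N.Normal]
    (hN : ∀ u ∈ N, ∃ n : ℕ, 0 < n ∧ ∃ f : F, (u : D) ^ n = algebraMap F D f)
    (V : ValuationSubring F) (s : V) (hs : s ∈ maximalIdeal V) (hs0 : s ≠ 0)
    (hsq : ∀ q : ℕ, q.Prime → (q : F) = 0 ∨ ∃ r ∈ maximalIdeal V, s = q * r)
    (x : Dˣ) (hx : x ∈ N) (a : D) : Commute a x := by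
  obtain ⟨M, hM1, hM2⟩ := exists_order (A := V) (F := F) (D := D)
  obtain ⟨s₁, h₁, hc⟩ := hM1 (a * x - x * a)
  obtain ⟨s₂, h₂, hx'⟩ := hM1 (x : D)⁻¹
  obtain ⟨s₃, h₃, ha⟩ := hM1 a
  -- `s₁`, `s₂`, `s₃` clear the denominators of `a * x - x * a`, `x⁻¹` and `a`. The factor `s` then
  -- puts both `g` and `⁅g, x⁆ = 1 + t • (a * x - x * a) * g⁻¹ * x⁻¹` in `1 + s • M`.
  set t : V := s * (s₁ * s₂ * s₃) with ht
  have ht0 : t ≠ 0 := mul_ne_zero hs0 (mul_ne_zero (mul_ne_zero h₁ h₂) h₃)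
  have hta : t • a = s • ((s₁ * s₂) • s₃ • a) := by simp only [ht, mul_smul]
  obtain ⟨hg0, hgM⟩ := hM2 s hs _ (M.smul_mem ha (s₁ * s₂))
  rw [← hta] at hg0 hgM
  set g : Dˣ := Units.mk0 _ hg0 with hg
  have hmem : ⁅g, x⁆ ∈ N := by
    rw [commutatorElement_def]
    exact N.mul_mem (Subgroup.Normal.conj_mem inferInstance x hx g) (N.inv_mem hx)
  obtain ⟨n, hn, f, hf⟩ := hN _ hmem
  obtain ⟨m, hm, hum⟩ := isOfFinOrder_commutator_of_pow_mem g x hn hf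
  have hgv : (g : D) = 1 + t • a := rfl
  have hform : ((⁅g, x⁆ : Dˣ) : D) =
      1 + s • ((s₁ • (a * x - x * a)) * (1 + t • a)⁻¹ * (s₂ • (x : D)⁻¹) * algebraMap V D s₃) := by
    have e1 : ((⁅g, x⁆ : Dˣ) : D) = g * x * (g : D)⁻¹ * (x : D)⁻¹ := by
      rw [commutatorElement_def]; simp
    have e2 : (g : D) * x = x * g + t • (a * x - x * a) := by
      rw [hgv, add_mul, mul_add, smul_sub, smul_mul_assoc, mul_smul_comm]
      simp
    rw [e1, e2, add_mul, add_mul, mul_assoc (x : D), mul_inv_cancel₀ g.ne_zero, mul_one,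
      mul_inv_cancel₀ x.ne_zero, ← hgv]
    congr 1
    rw [← Algebra.commutes s₃, ← Algebra.smul_def]
    simp only [smul_mul_assoc, mul_smul_comm, ht, mul_smul]
    rw [smul_comm s₂ s₁, smul_comm s₃ s₁, smul_comm s₃ s₂]
  have hone : ((⁅g, x⁆ : Dˣ) : D) = 1 := by
    refine eq_one_of_pow_eq_one_of_near_one M (fun s hs y hy => (hM2 s hs y hy).1) (s := s)
      (fun q hq => (hsq q hq).imp_left fun h => ?_) m hm _ ⟨_, ?_, hform⟩ hum
    · rw [← map_natCast (algebraMap F D), h, map_zero]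
    · exact mul_mem (mul_mem (mul_mem hc hgM) hx') (M.algebraMap_mem _)
  have hcomm : Commute (g : D) x := by
    have := commutatorElement_eq_one_iff_commute.1 (Units.ext hone)
    exact congrArg Units.val this
  rw [hgv] at hcomm
  have h5 : t • (a * x) = t • ((x : D) * a) := by
    have := hcomm.eq
    rwa [add_mul, mul_add, one_mul, mul_one, add_right_inj, smul_mul_assoc, mul_smul_comm] at this
  have h6 : (t : F) • (a * (x : D)) = (t : F) • ((x : D) * a) := h5
  exact smul_right_injective D (fun h => ht0 (Subtype.ext h)) h6

/-- A normal subgroup of the unit group of a finite-dimensional division algebra which is radical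
over the base field is central. -/
theorem commute_of_radical_of_finiteDimensional {F D : Type*} [Field F] [DivisionRing D]
    [Algebra F D] [FiniteDimensional F D] (N : Subgroup Dˣ) [N.Normal]
    (hN : ∀ u ∈ N, ∃ n : ℕ, 0 < n ∧ ∃ f : F, (u : D) ^ n = algebraMap F D f)
    (x : Dˣ) (hx : x ∈ N) (a : D) : Commute a x := by
  obtain ⟨p, hp⟩ := CharP.exists F
  obtain hp0 | rfl := CharP.char_is_prime_or_zero F p
  · have : Fact p.Prime := ⟨hp0⟩
    let : Algebra (ZMod p) F := ZMod.algebra F p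
    by_cases h : Algebra.IsAlgebraic (ZMod p) F
    · exact commute_of_algebraic_over_finite (k := ZMod p) (F := F) a x
    · obtain ⟨V, s, hs, hs0, hsq⟩ := exists_valuationSubring_of_charP F p h
      exact commute_of_radical_of_valuationSubring N hN V s hs hs0 hsq x hx a
  · have : CharZero F := CharP.charP_to_charZero F
    obtain ⟨V, s, hs, hs0, hsq⟩ := exists_valuationSubring_of_charZero F
    exact commute_of_radical_of_valuationSubring N hN V s hs hs0 (fun q hq => Or.inr (hsq q hq))
      x hx a

/-! ### Reduction to finite dimension -/

/-- The Cartan–Brauer–Hua argument: if `z` and its conjugates by `a` and `1 + a` lie in a division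
subring not containing `a`, then `z` commutes with `a`. -/
theorem commute_of_conj_mem {D : Type*} [DivisionRing D] {K : Subfield D} {a z : D} (ha : a ∉ K)
    (hz : z ∈ K) (h1 : a * z * a⁻¹ ∈ K) (h2 : (1 + a) * z * (1 + a)⁻¹ ∈ K) : Commute z a := by
  have ha0 : a ≠ 0 := by rintro rfl; exact ha K.zero_mem
  have ha1 : 1 + a ≠ 0 := by
    intro h
    rw [eq_neg_of_add_eq_zero_right h] at ha
    exact ha (K.neg_mem K.one_mem)
  set z₁ := a * z * a⁻¹ with hz₁
  set z₂ := (1 + a) * z * (1 + a)⁻¹ with hz₂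
  have e1 : z₁ * a = a * z := by rw [hz₁, inv_mul_cancel_right₀ ha0]
  have e2 : z₂ * (1 + a) = (1 + a) * z := by rw [hz₂, inv_mul_cancel_right₀ ha1]
  -- Were `z₁ ≠ z₂`, this relation would express `a` through elements of `K`.
  have e3 : (z₁ - z₂) * a = z₂ - z := by
    rw [mul_add, add_mul, mul_one, one_mul, ← e1] at e2
    rw [sub_mul, eq_sub_iff_add_eq, sub_add_eq_add_sub, sub_eq_iff_eq_add, add_comm, ← e2, add_comm]
  have e4 : z₁ - z₂ = 0 := by
    by_contra h
    exact ha (by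
      rw [← inv_mul_cancel_left₀ h a, e3]
      exact K.mul_mem (K.inv_mem (sub_mem h1 h2)) (sub_mem h2 hz))
  rw [e4, zero_mul] at e3
  rw [sub_eq_zero.1 e4, sub_eq_zero.1 e3.symm] at e1
  exact e1

/-- If a normal subgroup is radical over a proper division subring, then every element of the
division ring commutes with some power of a given element of the subgroup. -/
theorem exists_pow_commute_of_radical {D : Type*} [DivisionRing D] {K : Subfield D} (hK : K ≠ ⊤)
    {N : Subgroup Dˣ} [N.Normal] (hN : ∀ u ∈ N, ∃ n : ℕ, 0 < n ∧ (u : D) ^ n ∈ K)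
    {x : Dˣ} (hx : x ∈ N) (a : D) : ∃ n : ℕ, 0 < n ∧ Commute ((x : D) ^ n) a := by
  have conj : ∀ g : D, g ≠ 0 → ∃ n : ℕ, 0 < n ∧ ∀ m, g * (x : D) ^ (n * m) * g⁻¹ ∈ K := by
    intro g hg
    obtain ⟨n, hn, h⟩ := hN _ (Subgroup.Normal.conj_mem inferInstance x hx (Units.mk0 g hg))
    refine ⟨n, hn, fun m => ?_⟩
    have h' : (((Units.mk0 g hg) * x * (Units.mk0 g hg)⁻¹ : Dˣ) : D) ^ n =
        g * (x : D) ^ n * g⁻¹ := by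
      rw [← Units.val_pow_eq_pow_val, conj_pow]; simp
    rw [h'] at h
    have h2 := K.pow_mem h m
    rwa [← Units.val_mk0 hg, ← Units.val_inv_eq_inv_val, Units.conj_pow, ← pow_mul] at h2
  have main : ∀ a : D, a ∉ K → ∃ n : ℕ, 0 < n ∧ Commute ((x : D) ^ n) a := by
    intro a ha
    have ha0 : a ≠ 0 := by rintro rfl; exact ha K.zero_mem
    have ha1 : 1 + a ≠ 0 := by
      intro h
      rw [eq_neg_of_add_eq_zero_right h] at ha
      exact ha (K.neg_mem K.one_mem)
    obtain ⟨n₀, h₀, H₀⟩ := conj 1 one_ne_zero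
    obtain ⟨n₁, h₁, H₁⟩ := conj a ha0
    obtain ⟨n₂, h₂, H₂⟩ := conj (1 + a) ha1
    refine ⟨n₀ * n₁ * n₂, by positivity, commute_of_conj_mem ha ?_ ?_ ?_⟩
    · simpa [mul_assoc] using H₀ (n₁ * n₂)
    · rw [mul_comm n₀, mul_assoc n₁]; exact H₁ _
    · rw [mul_comm]; exact H₂ _
  by_cases ha : a ∈ K
  -- For `a` in `K`, both `c` and `a + c` lie outside `K`, and a power commuting with both commutes
  -- with `a`.
  · obtain ⟨c, hc⟩ : ∃ c, c ∉ K := by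
      by_contra! h
      exact hK (eq_top_iff.2 fun c _ => h c)
    obtain ⟨n, hn, h⟩ := main c hc
    obtain ⟨m, hm, h'⟩ := main (a + c) fun h => hc (by simpa using K.sub_mem h ha)
    refine ⟨n * m, by positivity, ?_⟩
    have h1 : Commute ((x : D) ^ (n * m)) c := by rw [pow_mul]; exact h.pow_left m
    have h2 : Commute ((x : D) ^ (n * m)) (a + c) := by
      rw [mul_comm, pow_mul]; exact h'.pow_left n
    simpa using h2.sub_right h1
  · exact main a ha

theorem theorem8p3 {D : Type*} [DivisionRing D] (hD : IsWeaklyLocallyFinite D)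
    (K : Subfield D) (hK : K ≠ ⊤) (N : Subgroup Dˣ) (hN : N.Normal)
    (hrad : IsRadicalOver K ((fun u : Dˣ => (u : D)) '' (N : Set Dˣ))) :
    (fun u : Dˣ => (u : D)) '' (N : Set Dˣ) ⊆ (Subring.center D : Set D) := by
  rintro _ ⟨x, hx, rfl⟩
  refine Subring.mem_center_iff.2 fun y => ?_
  have hrad' : ∀ u ∈ N, ∃ n : ℕ, 0 < n ∧ (u : D) ^ n ∈ K := fun u hu => hrad _ ⟨u, hu, rfl⟩
  set E : Subfield D := Subfield.closure {(x : D), y} with hE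
  have hxE : (x : D) ∈ E := Subfield.subset_closure (by simp)
  have hyE : y ∈ E := Subfield.subset_closure (by simp)
  have : FiniteDimensional (Subring.center E) E := hD {(x : D), y} (Set.toFinite _)
  let φ : Eˣ →* Dˣ := Units.map E.subtype.toMonoidHom
  have hrad'' : ∀ u ∈ N.comap φ, ∃ n : ℕ, 0 < n ∧
      ∃ f : Subring.center E, (u : E) ^ n = algebraMap (Subring.center E) E f := by
    intro u hu
    obtain ⟨n, hn, hnx⟩ := exists_pow_commute_of_radical hK hrad' hu (x : D)
    obtain ⟨m, hm, hmy⟩ := exists_pow_commute_of_radical hK hrad' hu y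
    refine ⟨n * m, by positivity, ⟨(u : E) ^ (n * m), Subring.mem_center_iff.2 fun g => ?_⟩, rfl⟩
    -- The centralizer is a division subring containing `x` and `y`, hence all of `E`.
    let C : Subfield D :=
      { Subring.centralizer {((u : E) : D) ^ (n * m)} with
        inv_mem' := fun z hz => by
          rintro _ rfl
          exact Commute.inv_right₀ (hz _ rfl) }
    have hle : E ≤ C := by
      refine Subfield.closure_le.2 ?_
      rintro z (rfl | rfl) _ rfl
      · rw [pow_mul]; exact hnx.pow_left m
      · rw [mul_comm n, pow_mul]; exact hmy.pow_left n
    exact Subtype.ext (hle g.2 _ rfl).symm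
  have hcomm := commute_of_radical_of_finiteDimensional (F := Subring.center E) (N.comap φ) hrad''
    (Units.mk0 (⟨x, hxE⟩ : E) fun h => x.ne_zero (congrArg Subtype.val h))
    (by
      have : φ (Units.mk0 (⟨x, hxE⟩ : E) fun h => x.ne_zero (congrArg Subtype.val h)) = x :=
        Units.ext rfl
      rwa [Subgroup.mem_comap, this]) ⟨y, hyE⟩
  exact congrArg Subtype.val hcomm.eq
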